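/- Let $H$ be a complex separable Hilbert space. For a bounded operator $x$ on $H$ put $|x|=(x^*x)^{1/2}$, and for a compact operator $x$ let $s_1(x)\ge s_2(x)\ge\dots\ge 0$ be its singular values, i.e. the positive eigenvalues of $|x|$ in decreasing order, repeated according to multiplicity and continued by zeros if there are finitely many. For a positive bounded operator $A$ let $\mathrm{Tr}(A)=\sum_k\langle e_k,Ae_k\rangle\in[0,\infty]$ for any orthonormal basis $(e_k)$ of $H$. For $1\le p<\infty$ let $S_p$ be the set of compact operators $x$ on $H$ with $\sum_n s_n(x)^p<\infty$, and $\|x\|_p=\big(\sum_n s_n(x)^p\big)^{1/p}$. An Orlicz function is a convex, nondecreasing, continuous $\varphi:[0,\infty)\to[0,\infty]$ with $\varphi(0)=0$, $\varphi(\alpha)>0$ for $\alpha>0$ and $\varphi(\alpha)\to\infty$ as $\alpha\to\infty$; $\varphi\in\delta_2(0)$ means that there are $u_0>0$ and $k>2$ with $\varphi(2u)\le k\varphi(u)$ for $0\le u\le u_0$. The Luxemburg norm of a compact operator $x$ is $\|x\|_\varphi=\inf\{\lambda>0:\sum_n\varphi(s_n(x)/\lambda)\le 1\}$. **Corollary.**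 1. Let $1\le p<\infty$ and $0\ne x\in S_p$. With $\varphi(t)=t^p$, $$\mathrm{Tr}\Big(\frac{|x|^p}{\|x\|_\varphi^p}\Big)=1,\qquad \mathrm{Tr}\Big(\frac{|x|^p}{\|x\|_p^p}\Big)=\frac{\mathrm{Tr}(|x|^p)}{\|x\|_p^p}=1 .$$ 2. Let $1\le p<\infty$ and $x,y\in S_p$. Then $\mathrm{Tr}(|x+y|^p)<\infty$, $$\mathrm{Tr}(|x+y|^p)\le 2^{p-1}\big(\mathrm{Tr}(|x|^p)+\mathrm{Tr}(|y|^p)\big)$$ and $$\sum_n s_n(|x+y|^p)\le 2^{p-1}\Big(\sum_n s_n(|x|^p)+\sum_n s_n(|y|^p)\Big).$$ 3. (Hölder inequality) Let $1<p,q<\infty$ with $\frac1p+\frac1q=1$, $x\in S_p$ and $y\in S_q$. Then $\mathrm{Tr}(|xy|)<\infty$, $\mathrm{Tr}(|xy|)\le\|x\|_p\|y\|_q$ and $$\sum_n s_n(|xy|)\le\Big(\sum_n s_n(|x|)^p\Big)^{1/p}\Big(\sum_n s_n(|y|)^q\Big)^{1/q}=\big(\mathrm{Tr}(|x|^p)\big)^{1/p}\big(\mathrm{Tr}(|y|^q)\big)^{1/q}.$$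 In the case $p=1$, $q=\infty$: if $x\in S_1$ and $y$ is a bounded operator with operator norm $\|y\|_\infty$, then $\mathrm{Tr}(|xy|)<\infty$, $\mathrm{Tr}(|xy|)\le\|x\|_1\|y\|_\infty=\mathrm{Tr}(|x|)\|y\|_\infty$ and $\sum_n s_n(|xy|)\le\big(\sum_n s_n(|x|)\big)\|y\|_\infty$, where moreover $\|x\|_1=\mathrm{Tr}(|x|)$. 4. Let $\varphi\in\delta_2(0)$ be an Orlicz function that is invertible, i.e. a bijection of $[0,\infty)$ onto $[0,\infty)$, and let $(e_n)$ be an orthonormal basis of $H$. Then, for every $n$, the rank-one projection $e_n\otimes e_n:\xi\mapsto\langle e_n,\xi\rangle e_n$ satisfies $$\|e_n\otimes e_n\|_\varphi=\frac{1}{\varphi^{-1}(1)} .$$ -/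

import Mathlib

open scoped NNReal ENNReal

noncomputable section

namespace SchattenOrlicz

/-- An Orlicz function: a convex, nondecreasing, continuous `φ : [0,∞) → [0,∞]` with `φ 0 = 0`,
`φ a > 0` for `a > 0` and `φ a → ∞` as `a → ∞`. -/
structure IsOrlicz (φ : ℝ≥0 → ℝ≥0∞) : Prop where
  convex : ConvexOn ℝ≥0 Set.univ φ
  mono : Monotone φ
  continuous : Continuous φ
  map_zero : φ 0 = 0
  pos : ∀ a : ℝ≥0, 0 < a → 0 < φ a
  tendsto_top : Filter.Tendsto φ Filter.atTop (nhds ∞)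

/-- The condition `δ₂` near zero. -/
def DeltaTwoZero (φ : ℝ≥0 → ℝ≥0∞) : Prop :=
  ∃ u₀ k : ℝ≥0, 0 < u₀ ∧ 2 < k ∧ ∀ u : ℝ≥0, u ≤ u₀ → φ (2 * u) ≤ (k : ℝ≥0∞) * φ u

/-- The power function `t ↦ t ^ p` on `[0,∞)`. -/
def powFun (p : ℝ) : ℝ≥0 → ℝ≥0∞ := fun t => (t : ℝ≥0∞) ^ p

variable {H : Type*} [NormedAddCommGroup H] [InnerProductSpace ℂ H] [CompleteSpace H]

/-- The span of the eigenvectors of `|x|` with eigenvalue at least `t`; its dimension is the number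
of eigenvalues of `|x|` that are at least `t`, counted with multiplicity. -/
def eigenspaceGE (x : H →L[ℂ] H) (t : ℝ≥0) : Submodule ℂ H :=
  ⨆ r : {r : ℝ≥0 // t ≤ r},
    Module.End.eigenspace ((CFC.abs x : H →L[ℂ] H) : H →ₗ[ℂ] H) (((r : ℝ≥0) : ℝ) : ℂ)

/-- The singular values of a compact operator `x`, indexed from `0`: `singularValue x n` is the
`n`-th entry of the list of the positive eigenvalues of `|x|` in decreasing order, each repeated
according to its multiplicity, the list being continued by zeros if it is finite. Equivalently,
it is the largest `t > 0` such that `|x|` has more than `n` eigenvalues `≥ t`, counted with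
multiplicity, and it is `0` (the supremum of the empty set) if there is no such `t`. -/
def singularValue (x : H →L[ℂ] H) (n : ℕ) : ℝ≥0 :=
  sSup {t : ℝ≥0 | 0 < t ∧ (n : Cardinal) < Module.rank ℂ (eigenspaceGE x t)}

/-- The Schatten norm `(∑ₙ sₙ(x) ^ p) ^ (1 / p)` of a compact operator, with values in `[0,∞]`. -/
def schattenNorm (p : ℝ) (x : H →L[ℂ] H) : ℝ≥0∞ :=
  (∑' n, (singularValue x n : ℝ≥0∞) ^ p) ^ (1 / p)

/-- The Schatten class `S_p`: the compact operators with `∑ₙ sₙ(x) ^ p < ∞`. -/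
def schattenClass (H : Type*) [NormedAddCommGroup H] [InnerProductSpace ℂ H] [CompleteSpace H]
    (p : ℝ) : Set (H →L[ℂ] H) :=
  {x | IsCompactOperator x ∧ ∑' n, (singularValue x n : ℝ≥0∞) ^ p < ∞}

/-- The Luxemburg norm `inf {r > 0 | ∑ₙ φ (sₙ(x) / r) ≤ 1}` of a compact operator, with values in
`[0,∞]` (it is `∞` if there is no such `r`). -/
def luxemburgNorm (φ : ℝ≥0 → ℝ≥0∞) (x : H →L[ℂ] H) : ℝ≥0∞ :=
  ⨅ r : {r : ℝ≥0 // 0 < r ∧ ∑' n, φ (singularValue x n / r) ≤ 1}, ((r : ℝ≥0) : ℝ≥0∞)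

/-- The trace `∑ᵢ ⟨eᵢ, A eᵢ⟩ ∈ [0,∞]` of a positive operator `A` in an orthonormal basis `e`.
It does not depend on the basis, see `posTrace_eq_tsum`. -/
def posTrace (A : H →L[ℂ] H) : ℝ≥0∞ :=
  ∑' i, ENNReal.ofReal (RCLike.re (inner ℂ ((exists_hilbertBasis ℂ H).choose_spec.choose i)
    (A ((exists_hilbertBasis ℂ H).choose_spec.choose i))))

theorem ofReal_inner_mul_self {ι κ : Type*} (b : HilbertBasis ι ℂ H) (c : HilbertBasis κ ℂ H)
    {B : H →L[ℂ] H} (hsym : ∀ u v : H, inner ℂ (B u) v = inner ℂ u (B v)) (i : ι) :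
    ENNReal.ofReal (RCLike.re (inner ℂ (b i) ((B * B) (b i)))) =
      ∑' j, ENNReal.ofReal (‖inner ℂ (c j) (B (b i))‖ ^ 2) := by
  have h := (c.hasSum_inner_mul_inner (B (b i)) (B (b i))).mapL Complex.reCLM
  have h2 : HasSum (fun j => ‖inner ℂ (c j) (B (b i))‖ ^ 2)
      (RCLike.re (inner ℂ (b i) ((B * B) (b i)))) := by
    convert! h using 1
    · funext j
      rw [← inner_conj_symm (B (b i)) (c j), ← Complex.normSq_eq_conj_mul_self]
      simp [Complex.normSq_eq_norm_sq, -Complex.ofReal_pow]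
    · rw [hsym]
      rfl
  rw [← h2.tsum_eq, ENNReal.ofReal_tsum_of_nonneg (fun _ => by positivity) h2.summable]

/-- The trace of a positive operator may be computed in any orthonormal basis. -/
theorem posTrace_eq_tsum {ι : Type*} (b : HilbertBasis ι ℂ H) {A : H →L[ℂ] H} (hA : 0 ≤ A) :
    posTrace A = ∑' i, ENNReal.ofReal (RCLike.re (inner ℂ (b i) (A (b i)))) := by
  obtain ⟨B, hB, rfl⟩ : ∃ B : H →L[ℂ] H, IsSelfAdjoint B ∧ B * B = A :=
    ⟨CFC.sqrt A, (CFC.sqrt_nonneg A).isSelfAdjoint, CFC.sqrt_mul_sqrt_self A⟩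
  have hsym : ∀ u v : H, inner ℂ (B u) v = inner ℂ u (B v) := fun u v =>
    (ContinuousLinearMap.isSelfAdjoint_iff_isSymmetric.1 hB) u v
  set c := (exists_hilbertBasis ℂ H).choose_spec.choose
  change ∑' j, ENNReal.ofReal (RCLike.re (inner ℂ (c j) ((B * B) (c j)))) = _
  rw [tsum_congr (ofReal_inner_mul_self b c hsym), tsum_congr (ofReal_inner_mul_self c b hsym),
    ENNReal.tsum_comm]
  refine tsum_congr fun j => tsum_congr fun i => ?_
  rw [← hsym, norm_inner_symm]

end SchattenOrlicz

end

open SchattenOrlicz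

/-! For compact `x`, the spectral theorem makes `|x|` diagonal in an orthonormal basis `b` with
eigenvalues `μ` tending to zero. The singular values list the positive `μ i` with the same
multiplicities, so `∑ g (s_n)` equals `∑ g (μ i)` whenever `g 0 = 0`
(`IsDiagonal.tsum_singularValue`), and the traces are sums over `μ` as well. The normalisations and
the rank-one norm follow from this.

The inequalities avoid any min-max theory. Writing `x = ∑ μ_i ⟪b_i, ·⟫ c_i`, the key bound is `∑
|⟪f_k, x e_k⟫|^p ≤ ∑ μ_i^p` for all Bessel families `e`, `f`
(`IsDiagonal.tsum_enorm_inner_rpow_le`). It is Jensen's inequality for a doubly substochastic matrix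
of weights, with equality at the singular vectors. Testing `x` and `y` on the singular vectors of `x
+ y` gives the quasi-triangle inequality. Expanding `x * y` through the decomposition of `x` reduces
Hölder to the scalar case and the same bound for `y`. -/

noncomputable section

namespace SchattenOrlicz

variable {H : Type*} [NormedAddCommGroup H] [InnerProductSpace ℂ H] [CompleteSpace H]

/-! ### Diagonal operators and the spectral theorem -/

/-- The positive operator `A` is diagonal in the orthonormal basis `b`, with eigenvalues `μ`
tending to zero. -/
structure IsDiagonal {ι : Type*} (b : HilbertBasis ι ℂ H) (μ : ι → ℝ≥0) (A : H →L[ℂ] H) :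
    Prop where
  nonneg : 0 ≤ A
  apply_basis : ∀ i, A (b i) = ((μ i : ℝ) : ℂ) • b i
  finite : ∀ t : ℝ≥0, 0 < t → {i | t ≤ μ i}.Finite

/-- The component of `A (b i) - A (b j)` along `b i` is `μ i ≥ t`. Infinitely many such indices
would give a `t`-separated sequence inside a compact set. -/
theorem finite_le_eigenvalue {A : H →L[ℂ] H} (hA : IsCompactOperator A) {ι : Type*} {b : ι → H}
    (hb : Orthonormal ℂ b) {μ : ι → ℝ≥0} (h : ∀ i, A (b i) = ((μ i : ℝ) : ℂ) • b i)
    {t : ℝ≥0} (ht : 0 < t) : {i | t ≤ μ i}.Finite := by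
  by_contra hinf
  replace hinf : {i | t ≤ μ i}.Infinite := hinf
  let f := hinf.natEmbedding _
  obtain ⟨K, hK, hKA⟩ := hA.image_closedBall_subset_compact (f := (A : H →ₗ[ℂ] H)) 1
  have hmem : ∀ n, A (b (f n)) ∈ K := fun n => hKA ⟨b (f n), by simp [hb.1], rfl⟩
  obtain ⟨a, -, φ, hφ, hlim⟩ := hK.tendsto_subseq hmem
  obtain ⟨N, hN⟩ := Metric.cauchySeq_iff'.1 hlim.cauchySeq t (by exact_mod_cast ht)
  have h1 := hN (N + 1) (by omega)
  set i : ι := (f (φ (N + 1))).1 with hi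
  set j : ι := (f (φ N)).1 with hj
  have hij : i ≠ j := fun h => by
    have := hφ.injective (f.injective (Subtype.ext h))
    omega
  have hin : t ≤ μ i := (f (φ (N + 1))).2
  have h2 : inner ℂ (b i) (A (b i) - A (b j)) = ((μ i : ℝ) : ℂ) := by
    rw [h, h, inner_sub_right, inner_smul_right, inner_smul_right, hb.2 hij,
      inner_self_eq_norm_sq_to_K, hb.1]
    simp
  have h3 := norm_inner_le_norm (𝕜 := ℂ) (b i) (A (b i) - A (b j))
  rw [h2, hb.1, one_mul, ← dist_eq_norm] at h3
  have h4 : (μ i : ℝ) < t := by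
    refine lt_of_le_of_lt ?_ h1
    simpa using h3
  exact absurd hin (not_le.2 (by exact_mod_cast h4))

/-- The spectral theorem for positive compact operators. -/
theorem exists_isDiagonal.{u} {H : Type u} [NormedAddCommGroup H] [InnerProductSpace ℂ H]
    [CompleteSpace H] {A : H →L[ℂ] H} (hA : IsCompactOperator A) (hpos : 0 ≤ A) :
    ∃ (ι : Type u) (b : HilbertBasis ι ℂ H) (μ : ι → ℝ≥0), IsDiagonal b μ A := by
  have hP : A.IsPositive := (ContinuousLinearMap.nonneg_iff_isPositive A).1 hpos
  have hsym : (A : H →ₗ[ℂ] H).IsSymmetric := hP.isSymmetric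
  let E : ℂ → Submodule ℂ H := fun r => Module.End.eigenspace (A : H →ₗ[ℂ] H) r
  have hcl : ∀ r, CompleteSpace (E r) := fun r => by
    have : IsClosed (E r : Set H) := by
      have : (E r : Set H) = {v | A v = r • v} := by
        ext v
        simp [E]
      rw [this]
      exact isClosed_eq A.continuous (continuous_const_smul r)
    exact this.completeSpace_coe
  choose w c hc using fun r => exists_hilbertBasis ℂ (E r)
  have horth : OrthogonalFamily ℂ (fun r => E r) fun r => (E r).subtypeₗᵢ :=
    hsym.orthogonalFamily_eigenspaces
  let b₀ : (Σ r, w r) → H := fun s => (c s.1 s.2 : E s.1)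
  have hb₀ : Orthonormal ℂ b₀ :=
    horth.orthonormal_sigma_orthonormal (v_family := fun r => c r) fun r => (c r).orthonormal
  -- A vector orthogonal to every chosen basis vector is orthogonal to each eigenspace, and for a
  -- compact symmetric operator the eigenspaces have trivial common orthogonal complement.
  have hspan : (Submodule.span ℂ (Set.range b₀))ᗮ = ⊥ := by
    rw [eq_bot_iff, ← ContinuousLinearMap.orthogonalComplement_iSup_eigenspaces_eq_bot hA hsym]
    intro v hv
    rw [Submodule.mem_orthogonal] at hv
    rw [Submodule.mem_orthogonal']
    intro u hu
    induction hu using Submodule.iSup_induction' with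
    | mem r u hu =>
      have h1 := ((c r).hasSum_repr ⟨u, hu⟩).mapL
        ((innerSL ℂ v).comp (E r).subtypeL)
      have h2 : HasSum (fun _ : w r => (0 : ℂ)) (inner ℂ v u) := by
        convert! h1 using 1
        funext i
        have := hv (b₀ ⟨r, i⟩) (Submodule.subset_span ⟨_, rfl⟩)
        rw [← inner_eq_zero_symm] at this
        simp only [map_smul, ContinuousLinearMap.comp_apply, Submodule.subtypeL_apply,
          innerSL_apply_apply]
        rw [show inner ℂ v ((c r i : E r) : H) = 0 from this, smul_zero]
      exact h2.unique hasSum_zero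
    | zero => simp
    | add u u' _ _ h h' => rw [inner_add_right, h, h', add_zero]
  let b := HilbertBasis.mkOfOrthogonalEqBot hb₀ hspan
  have hb : ⇑b = b₀ := HilbertBasis.coe_mkOfOrthogonalEqBot hb₀ hspan
  have heig : ∀ s, A (b s) = s.1 • b s := fun s => by
    rw [hb]
    exact Module.End.mem_eigenspace_iff.1 (c s.1 s.2).2
  -- Positivity forces `⟪b s, A (b s)⟫`, which is the eigenvalue `s.1`, to be real and nonnegative.
  have hval : ∀ s : Σ r, w r, ((s.1.re.toNNReal : ℝ) : ℂ) = s.1 := fun s => by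
    have h1 := hP.inner_nonneg_right (b s)
    rw [heig, inner_smul_right, inner_self_eq_norm_sq_to_K, b.orthonormal.1] at h1
    simp only [Complex.coe_algebraMap, Complex.ofReal_one, one_pow, mul_one] at h1
    rw [Real.coe_toNNReal _ (Complex.le_def.1 h1).1]
    exact (Complex.eq_re_of_ofReal_le h1).symm
  have heig' : ∀ s, A (b s) = (((fun s : Σ r, w r => s.1.re.toNNReal) s : ℝ) : ℂ) • b s :=
    fun s => by rw [heig s]; exact congrArg (· • b s) (hval s).symm
  exact ⟨_, b, fun s => s.1.re.toNNReal, hpos, heig',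
    fun t ht => finite_le_eigenvalue hA b.orthonormal heig' ht⟩

/-! ### Powers and singular values of diagonal operators -/

/-- The continuous functional calculus acts on eigenvectors by the function. -/
theorem cfcHom_apply_eigenvector {A : H →L[ℂ] H} (hA : IsSelfAdjoint A) {v : H} {r : ℝ}
    (h : A v = (r : ℂ) • v) (hr : r ∈ spectrum ℝ A) (f : C(spectrum ℝ A, ℝ)) :
    cfcHom (R := ℝ) hA f v = ((f ⟨r, hr⟩ : ℝ) : ℂ) • v := by
  -- Stone–Weierstrass: the functions with this property form a closed star subalgebra containing
  -- the constants and the identity.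
  induction f using ContinuousMap.induction_on_of_compact with
  | const s =>
    have : cfcHom (R := ℝ) hA (.const _ s) = algebraMap ℝ (H →L[ℂ] H) s :=
      AlgHomClass.commutes (cfcHom (R := ℝ) hA) s
    rw [this, Algebra.algebraMap_eq_smul_one]
    simp
  | id => rw [cfcHom_id hA]; simpa using h
  | star_id => rw [map_star, cfcHom_id hA, hA.star_eq]; simpa using h
  | add f g hf hg => rw [map_add]; simp [hf, hg, add_smul]
  | mul f g hf hg =>
    rw [map_mul]
    simp [hf, hg, mul_smul, smul_comm (f ⟨r, hr⟩ : ℂ)]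
  | frequently f hf =>
    have hcl : IsClosed {g : C(spectrum ℝ A, ℝ) |
        cfcHom (R := ℝ) hA g v = ((g ⟨r, hr⟩ : ℝ) : ℂ) • v} := by
      refine isClosed_eq ?_ ?_
      · exact ((ContinuousLinearMap.apply ℂ H v).continuous).comp (cfcHom_continuous hA)
      · exact (Complex.continuous_ofReal.comp (continuous_eval_const _)).smul
          continuous_const
    exact hcl.closure_eq.subset (mem_closure_iff_frequently.2 hf)

theorem rpow_apply_eigenvector {A : H →L[ℂ] H} (hA : 0 ≤ A) {v : H} {r : ℝ≥0}
    (h : A v = ((r : ℝ) : ℂ) • v) {p : ℝ} (hp : 0 ≤ p) :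
    (A ^ p) v = (((r ^ p : ℝ≥0) : ℝ) : ℂ) • v := by
  rcases eq_or_ne v 0 with rfl | hv
  · simp
  -- `r - A` kills `v ≠ 0`, hence is not invertible.
  have hs : (r : ℝ) ∈ spectrum ℝ A := by
    intro hu
    have h0 : (algebraMap ℝ (H →L[ℂ] H) r - A) v = 0 := by
      simp [Algebra.algebraMap_eq_smul_one, h]
    obtain ⟨u, hu⟩ := hu
    apply hv
    have h1 : ((↑u⁻¹ : H →L[ℂ] H) * (u : H →L[ℂ] H)) v = v := by simp
    rw [← h1, mul_apply_eq_comp, hu, h0, map_zero]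
  have hc : ContinuousOn (fun x : ℝ => x ^ p) (spectrum ℝ A) :=
    (Real.continuous_rpow_const hp).continuousOn
  rw [CFC.rpow_eq_cfc_real, cfc_apply _ A hA.isSelfAdjoint hc,
    cfcHom_apply_eigenvector hA.isSelfAdjoint h hs]
  simp

namespace IsDiagonal

variable {ι : Type*} {b : HilbertBasis ι ℂ H} {μ : ι → ℝ≥0} {A : H →L[ℂ] H}

theorem rpow (hA : IsDiagonal b μ A) {p : ℝ} (hp : 0 < p) :
    IsDiagonal b (fun i => μ i ^ p) (A ^ p) where
  nonneg := CFC.rpow_nonneg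
  apply_basis i := rpow_apply_eigenvector hA.nonneg (hA.apply_basis i) hp.le
  finite t ht := by
    refine (hA.finite (t ^ (1 / p)) (NNReal.rpow_pos ht)).subset fun i hi => ?_
    have := NNReal.rpow_le_rpow (z := 1 / p) hi (by positivity)
    simpa [← NNReal.rpow_mul, hp.ne'] using this

theorem posTrace_eq (hA : IsDiagonal b μ A) : posTrace A = ∑' i, (μ i : ℝ≥0∞) := by
  rw [posTrace_eq_tsum b hA.nonneg]
  refine tsum_congr fun i => ?_
  rw [hA.apply_basis, inner_smul_right, inner_self_eq_norm_sq_to_K, b.orthonormal.1]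
  simp

theorem inner_apply (hA : IsDiagonal b μ A) (i : ι) (v : H) :
    inner ℂ (b i) (A v) = ((μ i : ℝ) : ℂ) * inner ℂ (b i) v := by
  have hsym := ((ContinuousLinearMap.nonneg_iff_isPositive A).1 hA.nonneg).isSymmetric
  have := hsym (b i) v
  simp only [ContinuousLinearMap.coe_coe] at this
  rw [← this, hA.apply_basis, inner_smul_left]
  simp

/-- An eigenvector has zero coordinates at basis vectors with another eigenvalue. Since only
finitely many `μ i` reach `t`, its expansion is a finite sum and no closure of the span is needed.
-/
theorem eigenspaceGE_eq (hA : IsDiagonal b μ A) {t : ℝ≥0} (ht : 0 < t) :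
    eigenspaceGE A t = Submodule.span ℂ (b '' {i | t ≤ μ i}) := by
  rw [eigenspaceGE, CFC.abs_of_nonneg A hA.nonneg]
  apply le_antisymm
  · refine iSup_le fun r v hv => ?_
    have hv' : A v = ((((r : ℝ≥0) : ℝ)) : ℂ) • v := Module.End.mem_eigenspace_iff.1 hv
    have h0 : ∀ i, μ i ≠ r → b.repr v i = 0 := fun i hi => by
      have h1 := hA.inner_apply i v
      rw [hv', inner_smul_right] at h1
      rw [b.repr_apply_apply]
      by_contra h2
      exact hi (NNReal.eq (Complex.ofReal_injective (mul_right_cancel₀ h2 h1).symm))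
    have hs := b.hasSum_repr v
    rw [← hs.tsum_eq, tsum_eq_sum (s := (hA.finite t ht).toFinset)]
    · refine Submodule.sum_mem _ fun i hi => Submodule.smul_mem _ _ (Submodule.subset_span ⟨i, ?_, rfl⟩)
      simpa using hi
    · intro i hi
      rw [h0 i, zero_smul]
      rintro h
      exact hi (by simpa [h] using r.2)
  · rw [Submodule.span_le]
    rintro _ ⟨i, hi, rfl⟩
    exact Submodule.mem_iSup_of_mem (⟨μ i, hi⟩ : {r : ℝ≥0 // t ≤ r})
      (Module.End.mem_eigenspace_iff.2 (hA.apply_basis i))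

theorem rank_eigenspaceGE (hA : IsDiagonal b μ A) {t : ℝ≥0} (ht : 0 < t) :
    Module.rank ℂ (eigenspaceGE A t) = ({i | t ≤ μ i}.ncard : Cardinal) := by
  have hli := (b.orthonormal.linearIndependent.linearIndepOn {i | t ≤ μ i}).id_image
  rw [hA.eigenspaceGE_eq ht, rank_span_set hli, ← Set.cast_ncard ((hA.finite t ht).image b),
    Set.ncard_image_of_injective _ b.orthonormal.linearIndependent.injective]

/-- The content is that the supremum is attained, because the eigenvalues cannot accumulate at a
positive `t` from below. -/
theorem le_singularValue_iff (hA : IsDiagonal b μ A) {t : ℝ≥0} (ht : 0 < t) (n : ℕ) :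
    t ≤ singularValue A n ↔ n < {i | t ≤ μ i}.ncard := by
  have hset : {t : ℝ≥0 | 0 < t ∧ (n : Cardinal) < Module.rank ℂ (eigenspaceGE A t)} =
      {t : ℝ≥0 | 0 < t ∧ n < {i | t ≤ μ i}.ncard} := by
    ext s
    refine and_congr_right fun hs => ?_
    rw [hA.rank_eigenspaceGE hs, Nat.cast_lt]
  have hmono : ∀ {s s' : ℝ≥0}, 0 < s → s ≤ s' → {i | s' ≤ μ i}.ncard ≤ {i | s ≤ μ i}.ncard :=
    fun hs h => Set.ncard_le_ncard (fun i (hi : _ ≤ _) => h.trans hi) (hA.finite _ hs)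
  rw [singularValue, hset]
  set S := {t : ℝ≥0 | 0 < t ∧ n < {i | t ≤ μ i}.ncard}
  have hbdd : BddAbove S := by
    refine ⟨‖A‖₊, fun s hs => ?_⟩
    obtain ⟨i, hi⟩ := Set.nonempty_of_ncard_ne_zero (Nat.ne_zero_of_lt hs.2)
    refine le_trans hi ?_
    have := A.le_opNNNorm (b i)
    rw [hA.apply_basis, nnnorm_smul] at this
    have hb1 : ‖b i‖₊ = 1 := NNReal.eq (b.orthonormal.1 i)
    simpa [hb1] using this
  constructor
  · intro hle
    by_contra hn
    have hfin := hA.finite (t / 2) (half_pos ht)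
    -- Choose `t'` above `t / 2` and above the finitely many eigenvalues in `[t / 2, t)`: levels
    -- `t'` and `t` then count the same eigenvalues.
    obtain ⟨t', ht', ht'0, hgap⟩ : ∃ t' < t, 0 < t' ∧ ∀ i, t' ≤ μ i → t ≤ μ i := by
      have hfin2 : {i | t / 2 ≤ μ i ∧ μ i < t}.Finite := hfin.subset fun i hi => hi.1
      obtain ⟨m, hm⟩ : ∃ m < t, ∀ i ∈ {i | t / 2 ≤ μ i ∧ μ i < t}, μ i ≤ m := by
        rcases Set.eq_empty_or_nonempty {i | t / 2 ≤ μ i ∧ μ i < t} with h | h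
        · exact ⟨0, ht, by simp [h]⟩
        · obtain ⟨i, hi, hmax⟩ := Set.exists_max_image _ μ hfin2 h
          exact ⟨μ i, hi.2, hmax⟩
      obtain ⟨t', h1, h2⟩ := exists_between (max_lt hm.1 (half_lt_self ht))
      refine ⟨t', h2, lt_of_le_of_lt zero_le h1, fun i hi => ?_⟩
      by_contra hlt
      have := hm.2 i ⟨((le_max_right _ _).trans h1.le).trans hi, not_le.1 hlt⟩
      exact absurd (hi.trans this) (not_le.2 ((le_max_left _ _).trans_lt h1))
    have hS : S.Nonempty := by
      by_contra hS
      rw [Set.not_nonempty_iff_eq_empty.1 hS] at hle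
      simp at hle
      exact ht.ne' hle
    obtain ⟨s, hs, hts⟩ := exists_lt_of_lt_csSup hS (ht'.trans_le hle)
    have h1 := hmono ht'0 hts.le
    have h2 : {i | t' ≤ μ i}.ncard ≤ {i | t ≤ μ i}.ncard :=
      Set.ncard_le_ncard (fun i hi => hgap i hi) (hA.finite t ht)
    have := hs.2
    omega
  · intro hn
    exact le_csSup hbdd ⟨ht, hn⟩

theorem encard_singularValue_ge (hA : IsDiagonal b μ A) {t : ℝ≥0} (ht : 0 < t) :
    {n | t ≤ singularValue A n}.encard = {i | t ≤ μ i}.encard := by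
  simp only [hA.le_singularValue_iff ht]
  rw [← (hA.finite t ht).cast_ncard_eq]
  have := Set.encard_coe_eq_coe_finsetCard (Finset.range {i | t ≤ μ i}.ncard)
  rw [Finset.card_range] at this
  rw [← this]
  congr 1
  ext n
  simp

theorem finite_singularValue_ge (hA : IsDiagonal b μ A) {t : ℝ≥0} (ht : 0 < t) :
    {n | t ≤ singularValue A n}.Finite := by
  simp only [hA.le_singularValue_iff ht]
  exact Set.finite_lt_nat _

end IsDiagonal

/-! ### Rearrangement of null families -/

/-- This turns a strict superlevel set into a closed one, where the hypothesis on cardinalities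
applies. -/
theorem exists_gap {ι : Type*} {μ : ι → ℝ≥0} (hμ : ∀ t, 0 < t → {i | t ≤ μ i}.Finite)
    {t : ℝ≥0} (ht : 0 < t) : ∃ s > t, ∀ i, t < μ i → s ≤ μ i := by
  have hfin : {i | t < μ i}.Finite := (hμ t ht).subset fun i (hi : t < μ i) => hi.le
  rcases Set.eq_empty_or_nonempty {i | t < μ i} with h | h
  · refine ⟨t + 1, lt_add_one t, fun i hi => ?_⟩
    exact absurd (show i ∈ {i | t < μ i} from hi) (by simp [h])
  · obtain ⟨i, hi, hmin⟩ := Set.exists_min_image _ μ hfin h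
    exact ⟨μ i, hi, hmin⟩

theorem encard_fiber_add {α : Type*} (f : α → ℝ≥0) (t : ℝ≥0) :
    (f ⁻¹' {t}).encard + {i | t < f i}.encard = {i | t ≤ f i}.encard := by
  rw [← Set.encard_union_eq]
  · congr 1
    ext i
    simp [le_iff_eq_or_lt, eq_comm]
  · rw [Set.disjoint_left]
    rintro i hi (hi' : t < f i)
    exact hi'.ne' hi

/-- Two null families whose closed superlevel sets have the same cardinalities take every positive
value equally often. -/
theorem encard_fiber_eq {ι κ : Type*} {μ : ι → ℝ≥0} {ν : κ → ℝ≥0}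
    (hμ : ∀ t, 0 < t → {i | t ≤ μ i}.Finite) (hν : ∀ t, 0 < t → {i | t ≤ ν i}.Finite)
    (h : ∀ t, 0 < t → {i | t ≤ μ i}.encard = {i | t ≤ ν i}.encard) {t : ℝ≥0} (ht : 0 < t) :
    (μ ⁻¹' {t}).encard = (ν ⁻¹' {t}).encard := by
  obtain ⟨s, hs, hμs⟩ := exists_gap hμ ht
  obtain ⟨s', hs', hνs⟩ := exists_gap hν ht
  have hm : t < min s s' := lt_min hs hs'
  have h1 : {i | t < μ i} = {i | min s s' ≤ μ i} := by
    ext i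
    exact ⟨fun hi => (min_le_left _ _).trans (hμs i hi), fun hi => hm.trans_le hi⟩
  have h2 : {i | t < ν i} = {i | min s s' ≤ ν i} := by
    ext i
    exact ⟨fun hi => (min_le_right _ _).trans (hνs i hi), fun hi => hm.trans_le hi⟩
  have h3 := h t ht
  rw [← encard_fiber_add μ t, ← encard_fiber_add ν t, h1, h2, h _ (ht.trans hm)] at h3
  refine WithTop.add_right_cancel ?_ h3
  exact Set.encard_ne_top_iff.2 (hν _ (ht.trans hm))

/-- Group both sums by value. The fibres over `0` may have different sizes, which `g 0 = 0` makes
harmless. -/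
theorem tsum_comp_eq {ι κ : Type*} {μ : ι → ℝ≥0} {ν : κ → ℝ≥0}
    (hμ : ∀ t, 0 < t → {i | t ≤ μ i}.Finite) (hν : ∀ t, 0 < t → {i | t ≤ ν i}.Finite)
    (h : ∀ t, 0 < t → {i | t ≤ μ i}.encard = {i | t ≤ ν i}.encard) {g : ℝ≥0 → ℝ≥0∞}
    (hg : g 0 = 0) : ∑' i, g (μ i) = ∑' i, g (ν i) := by
  rw [← ENNReal.tsum_fiberwise _ μ, ← ENNReal.tsum_fiberwise _ ν]
  refine tsum_congr fun t => ?_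
  have h1 : ∑' i : μ ⁻¹' {t}, g (μ i) = (μ ⁻¹' {t}).encard * g t := by
    rw [← ENNReal.tsum_set_const]
    exact tsum_congr fun i => congrArg g i.2
  have h2 : ∑' i : ν ⁻¹' {t}, g (ν i) = (ν ⁻¹' {t}).encard * g t := by
    rw [← ENNReal.tsum_set_const]
    exact tsum_congr fun i => congrArg g i.2
  rw [h1, h2]
  rcases eq_or_ne t 0 with rfl | ht
  · simp [hg]
  · rw [encard_fiber_eq hμ hν h (pos_iff_ne_zero.2 ht)]

/-- Sums over the singular values of a diagonal operator are sums over its eigenvalues. -/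
theorem IsDiagonal.tsum_singularValue {ι : Type*} {b : HilbertBasis ι ℂ H} {μ : ι → ℝ≥0}
    {A : H →L[ℂ] H} (hA : IsDiagonal b μ A) {g : ℝ≥0 → ℝ≥0∞} (hg : g 0 = 0) :
    ∑' n, g (singularValue A n) = ∑' i, g (μ i) :=
  tsum_comp_eq (fun _ ht => hA.finite_singularValue_ge ht) hA.finite
    (fun _ ht => hA.encard_singularValue_ge ht) hg


/-! ### Bessel families -/

/-- A family of vectors satisfying Bessel's inequality. -/
def IsBessel {ι : Type*} (h : ι → H) : Prop :=
  ∀ v, ∑' i, ‖inner ℂ (h i) v‖ₑ ^ 2 ≤ ‖v‖ₑ ^ 2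

theorem _root_.Orthonormal.isBessel {ι : Type*} {h : ι → H} (hh : Orthonormal ℂ h) :
    IsBessel h := fun v => by
  rw [ENNReal.tsum_eq_iSup_sum]
  refine iSup_le fun s => ?_
  have := hh.sum_inner_products_le v (s := s)
  have h2 : ∑ i ∈ s, ‖inner ℂ (h i) v‖₊ ^ 2 ≤ ‖v‖₊ ^ 2 := by
    rw [← NNReal.coe_le_coe]
    push_cast
    exact this
  simp only [enorm_eq_nnnorm]
  exact_mod_cast h2

namespace IsBessel

variable {ι κ : Type*} {h : ι → H}

theorem enorm_le_one (hh : IsBessel h) (i : ι) : ‖h i‖ₑ ≤ 1 := by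
  have h1 : ‖inner ℂ (h i) (h i)‖ₑ ^ 2 ≤ ‖h i‖ₑ ^ 2 := (ENNReal.le_tsum i).trans (hh (h i))
  rw [inner_self_eq_norm_sq_to_K] at h1
  simp only [enorm_eq_nnnorm] at h1 ⊢
  norm_cast at h1 ⊢
  have h2 : (‖h i‖ ^ 2) ^ 2 ≤ ‖h i‖ ^ 2 := by
    have := NNReal.coe_le_coe.2 h1
    simpa using this
  rw [← NNReal.coe_le_coe]
  simp only [coe_nnnorm, NNReal.coe_one]
  by_contra! hlt
  nlinarith [mul_pos (sub_pos.2 hlt) (sub_pos.2 hlt), sq_nonneg (‖h i‖ ^ 2 - 1)]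

theorem comp (hh : IsBessel h) {T : H →L[ℂ] H} (hT : ‖T‖ ≤ 1) : IsBessel fun i => T (h i) :=
  fun v => by
    simp only [← ContinuousLinearMap.adjoint_inner_right]
    refine (hh _).trans ?_
    have : ‖(ContinuousLinearMap.adjoint T) v‖₊ ≤ ‖v‖₊ := by
      have := (ContinuousLinearMap.adjoint T).le_of_opNorm_le
        ((LinearIsometryEquiv.norm_map _ T).trans_le hT) v
      rw [one_mul] at this
      exact this
    simp only [enorm_eq_nnnorm]
    gcongr

/-- The dual form of Bessel's inequality: pair the sum `u` with itself, apply Cauchy–Schwarz and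
Bessel, then cancel `‖u‖ ^ 2`. -/
theorem norm_sum_smul_sq_le (hh : IsBessel h) (s : Finset ι) (a : ι → ℂ) :
    ‖∑ i ∈ s, a i • h i‖ ^ 2 ≤ ∑ i ∈ s, ‖a i‖ ^ 2 := by
  set u := ∑ i ∈ s, a i • h i
  have h1 : ‖u‖ ^ 2 ≤ ∑ i ∈ s, ‖a i‖ * ‖inner ℂ (h i) u‖ := by
    have h2 : inner ℂ u u = ∑ i ∈ s, a i * inner ℂ u (h i) := by
      conv_lhs => arg 3; rw [show u = ∑ i ∈ s, a i • h i from rfl]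
      simp only [inner_sum, inner_smul_right]
    have h3 : ‖inner ℂ u u‖ = ‖u‖ ^ 2 := by rw [inner_self_eq_norm_sq_to_K]; simp
    rw [← h3, h2]
    refine (norm_sum_le _ _).trans (Finset.sum_le_sum fun i _ => ?_)
    rw [norm_mul, norm_inner_symm]
  have h4 : ∑ i ∈ s, ‖inner ℂ (h i) u‖ ^ 2 ≤ ‖u‖ ^ 2 := by
    have := (ENNReal.sum_le_tsum s).trans (hh u)
    simp only [enorm_eq_nnnorm] at this
    have h5 : ∑ i ∈ s, ‖inner ℂ (h i) u‖₊ ^ 2 ≤ ‖u‖₊ ^ 2 := by exact_mod_cast this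
    rw [← NNReal.coe_le_coe] at h5
    push_cast at h5
    exact h5
  have h5 := Finset.sum_mul_sq_le_sq_mul_sq s (fun i => ‖a i‖) fun i => ‖inner ℂ (h i) u‖
  have h6 : (‖u‖ ^ 2) ^ 2 ≤ (∑ i ∈ s, ‖a i‖ ^ 2) * ‖u‖ ^ 2 :=
    (pow_le_pow_left₀ (by positivity) h1 2).trans
      (h5.trans (mul_le_mul_of_nonneg_left h4 (by positivity)))
  rcases eq_or_lt_of_le (sq_nonneg ‖u‖) with h0 | h0
  · rw [← h0]; positivity
  · exact le_of_mul_le_mul_right (by rwa [sq (‖u‖ ^ 2)] at h6) h0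

/-- The image of a Bessel family under the contraction `∑ i ∈ s, ⟪f i, ·⟫ e i`. -/
theorem sum_inner_smul (hh : IsBessel h) {e f : κ → H} (he : IsBessel e) (hf : IsBessel f)
    (s : Finset κ) : IsBessel fun j => ∑ i ∈ s, inner ℂ (f i) (h j) • e i := fun v => by
  have h1 : ∀ j, inner ℂ (∑ i ∈ s, inner ℂ (f i) (h j) • e i) v =
      inner ℂ (h j) (∑ i ∈ s, inner ℂ (e i) v • f i) := fun j => by
    simp only [sum_inner, inner_sum, inner_smul_left, inner_smul_right, inner_conj_symm]
    exact Finset.sum_congr rfl fun i _ => mul_comm _ _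
  simp only [h1]
  refine (hh _).trans ?_
  refine le_trans ?_ ((ENNReal.sum_le_tsum s).trans (he v))
  have h2 := hf.norm_sum_smul_sq_le s fun i => inner ℂ (e i) v
  have h3 : ‖∑ i ∈ s, inner ℂ (e i) v • f i‖₊ ^ 2 ≤ ∑ i ∈ s, ‖inner ℂ (e i) v‖₊ ^ 2 := by
    rw [← NNReal.coe_le_coe]
    push_cast
    exact h2
  simp only [enorm_eq_nnnorm]
  exact_mod_cast h3

end IsBessel

/-! ### Scalar inequalities -/

theorem enorm_mul_le_half_add_sq (a b : ℂ) : ‖a‖ₑ * ‖b‖ₑ ≤ (‖a‖ₑ ^ 2 + ‖b‖ₑ ^ 2) / 2 := by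
  rw [ENNReal.le_div_iff_mul_le (by simp) (by simp)]
  simp only [enorm_eq_nnnorm]
  have := two_mul_le_add_sq ‖a‖₊ ‖b‖₊
  have h : ‖a‖₊ * ‖b‖₊ * 2 ≤ ‖a‖₊ ^ 2 + ‖b‖₊ ^ 2 := by
    calc _ = 2 * ‖a‖₊ * ‖b‖₊ := by ring
      _ ≤ _ := this
  exact_mod_cast h

/-- Jensen's inequality for the power function and a weight of total mass at most one. -/
theorem tsum_mul_rpow_le {ι : Type*} {p : ℝ} (hp : 1 ≤ p) {w : ι → ℝ≥0∞} (hw : ∑' i, w i ≤ 1)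
    (f : ι → ℝ≥0∞) : (∑' i, w i * f i) ^ p ≤ ∑' i, w i * f i ^ p := by
  have hp0 : 0 < p := by linarith
  have h : ∑' i, w i * f i ≤ (∑' i, w i * f i ^ p) ^ p⁻¹ := by
    rw [ENNReal.tsum_eq_iSup_sum]
    -- The finite inequality carries the factor `(∑ w) ^ (1 - p⁻¹)`, which is at most one.
    refine iSup_le fun s => (ENNReal.inner_le_weight_mul_Lp_of_nonneg s hp w f).trans ?_
    rw [← one_mul ((∑' i, w i * f i ^ p) ^ p⁻¹)]
    gcongr
    · exact ENNReal.rpow_le_one ((ENNReal.sum_le_tsum s).trans hw)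
        (sub_nonneg.2 (inv_le_one_of_one_le₀ hp))
    · exact ENNReal.sum_le_tsum s
  calc _ ≤ ((∑' i, w i * f i ^ p) ^ p⁻¹) ^ p := by gcongr
    _ = _ := by rw [← ENNReal.rpow_mul, inv_mul_cancel₀ hp0.ne', ENNReal.rpow_one]

theorem tsum_mul_le_Lp_mul_Lq {ι : Type*} {p q : ℝ} (hpq : p.HolderConjugate q)
    (f g : ι → ℝ≥0∞) :
    ∑' i, f i * g i ≤ (∑' i, f i ^ p) ^ (1 / p) * (∑' i, g i ^ q) ^ (1 / q) := by
  have hp := hpq.pos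
  have hq := hpq.symm.pos
  rw [ENNReal.tsum_eq_iSup_sum]
  refine iSup_le fun s => (ENNReal.inner_le_Lp_mul_Lq s f g hpq).trans ?_
  gcongr <;> exact ENNReal.sum_le_tsum s

/-! ### Singular value decomposition and the trace inequalities -/

theorem isCompactOperator_star_mul_self {x : H →L[ℂ] H} (hx : IsCompactOperator x) :
    IsCompactOperator (star x * x : H →L[ℂ] H) :=
  hx.clm_comp (star x)

/-- Diagonalise the compact operator `star x * x` and take square roots; compactness of `|x|` itself
is not needed. -/
theorem exists_isDiagonal_abs.{u} {H : Type u} [NormedAddCommGroup H] [InnerProductSpace ℂ H]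
    [CompleteSpace H] {x : H →L[ℂ] H} (hx : IsCompactOperator x) :
    ∃ (ι : Type u) (b : HilbertBasis ι ℂ H) (μ : ι → ℝ≥0), IsDiagonal b μ (CFC.abs x) := by
  obtain ⟨ι, b, μ, h⟩ := exists_isDiagonal (isCompactOperator_star_mul_self hx)
    (star_mul_self_nonneg x)
  refine ⟨ι, b, fun i => μ i ^ (1 / 2 : ℝ), ?_⟩
  rw [CFC.abs, CFC.sqrt_eq_rpow]
  exact h.rpow (by norm_num)

namespace IsDiagonal

variable {ι : Type*} {b : HilbertBasis ι ℂ H} {μ : ι → ℝ≥0} {x : H →L[ℂ] H}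

/-- The left singular vectors of `x` (zero where the singular value vanishes). -/
def leftVector (b : HilbertBasis ι ℂ H) (μ : ι → ℝ≥0) (x : H →L[ℂ] H) (i : ι) : H :=
  (((μ i : ℝ) : ℂ)⁻¹) • x (b i)

theorem inner_apply_apply (hx : IsDiagonal b μ (CFC.abs x)) (i j : ι) :
    inner ℂ (x (b i)) (x (b j)) = ((μ j : ℝ) : ℂ) ^ 2 * inner ℂ (b i) (b j) := by
  have h1 : (star x * x : H →L[ℂ] H) (b j) = (((μ j : ℝ) : ℂ) ^ 2) • b j := by
    rw [← CFC.abs_mul_abs, mul_apply_eq_comp, hx.apply_basis, map_smul, hx.apply_basis,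
      smul_smul, sq]
  rw [← ContinuousLinearMap.adjoint_inner_right, ← inner_smul_right, ← h1]
  rfl

theorem smul_leftVector (hx : IsDiagonal b μ (CFC.abs x)) (i : ι) :
    ((μ i : ℝ) : ℂ) • leftVector b μ x i = x (b i) := by
  -- If `μ i = 0` then `x (b i) = 0`, so the default value `0⁻¹ = 0` does no harm.
  rcases eq_or_ne (μ i) 0 with h0 | h0
  · have := hx.inner_apply_apply i i
    rw [h0] at this
    simp only [NNReal.coe_zero, Complex.ofReal_zero, ne_eq, OfNat.ofNat_ne_zero,
      not_false_eq_true, zero_pow, zero_mul, inner_self_eq_zero] at this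
    simp [h0, this]
  · rw [leftVector, smul_smul, mul_inv_cancel₀, one_smul]
    exact_mod_cast h0

theorem inner_leftVector_apply (hx : IsDiagonal b μ (CFC.abs x)) (i : ι) :
    inner ℂ (leftVector b μ x i) (x (b i)) = ((μ i : ℝ) : ℂ) := by
  rw [leftVector, inner_smul_left, hx.inner_apply_apply, inner_self_eq_norm_sq_to_K,
    b.orthonormal.1]
  rcases eq_or_ne (μ i) 0 with h0 | h0
  · simp [h0]
  · have : ((μ i : ℝ) : ℂ) ≠ 0 := by exact_mod_cast h0
    simp only [map_inv₀, Complex.conj_ofReal, Complex.coe_algebraMap, Complex.ofReal_one]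
    field_simp

/-- The left vectors with `μ i ≠ 0` are orthonormal; the others vanish and contribute nothing. -/
theorem isBessel_leftVector (hx : IsDiagonal b μ (CFC.abs x)) :
    IsBessel (leftVector b μ x) := fun v => by
  have horth : Orthonormal ℂ fun i : {i | μ i ≠ 0} => leftVector b μ x i := by
    classical
    rw [orthonormal_iff_ite]
    rintro ⟨i, hi⟩ ⟨j, hj⟩
    have hi' : ((μ i : ℝ) : ℂ) ≠ 0 := by exact_mod_cast hi
    simp only [leftVector, inner_smul_left, inner_smul_right, hx.inner_apply_apply,
      orthonormal_iff_ite.1 b.orthonormal i j, Subtype.mk.injEq, map_inv₀, Complex.conj_ofReal]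
    split_ifs with h
    · subst h
      field_simp
    · simp
  rw [← tsum_subtype_eq_of_support_subset (s := {i | μ i ≠ 0})]
  · exact horth.isBessel v
  · intro i hi h0
    apply hi
    simp [leftVector, h0]

/-- The singular value decomposition `x v = ∑ μᵢ ⟪bᵢ, v⟫ cᵢ`, in weak form. -/
theorem hasSum_inner (hx : IsDiagonal b μ (CFC.abs x)) (u v : H) :
    HasSum (fun i => ((μ i : ℝ) : ℂ) * (inner ℂ (b i) v * inner ℂ u (leftVector b μ x i)))
      (inner ℂ u (x v)) := by
  convert! (b.hasSum_repr v).mapL ((innerSL ℂ u).comp x) using 1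
  funext i
  simp only [map_smul, ContinuousLinearMap.comp_apply, innerSL_apply_apply, b.repr_apply_apply,
    ← hx.smul_leftVector i, smul_eq_mul]
  ring

/-- By the decomposition and the arithmetic-geometric mean inequality, `|⟪f_k, x e_k⟫| ≤ ∑ w_ki
μ_i`. Bessel bounds the row and column sums of `w` by one: rows allow Jensen, columns the final
summation over `k`. -/
theorem tsum_enorm_inner_rpow_le (hx : IsDiagonal b μ (CFC.abs x)) {κ : Type*} {e f : κ → H}
    (he : IsBessel e) (hf : IsBessel f) {p : ℝ} (hp : 1 ≤ p) :
    ∑' k, ‖inner ℂ (f k) (x (e k))‖ₑ ^ p ≤ ∑' i, (μ i : ℝ≥0∞) ^ p := by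
  set c := leftVector b μ x with hc
  have hb : IsBessel b := b.orthonormal.isBessel
  have hcB : IsBessel c := hx.isBessel_leftVector
  let w : κ → ι → ℝ≥0∞ := fun k i => (‖inner ℂ (b i) (e k)‖ₑ ^ 2 + ‖inner ℂ (c i) (f k)‖ₑ ^ 2) / 2
  have hsymm : ∀ u v : H, ‖inner ℂ u v‖ₑ = ‖inner ℂ v u‖ₑ := fun u v => by
    rw [← ofReal_norm, ← ofReal_norm, norm_inner_symm]
  have half : ∀ {s t : ℝ≥0∞}, s ≤ 1 → t ≤ 1 → (s + t) / 2 ≤ 1 := fun hs ht =>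
    ENNReal.div_le_of_le_mul ((add_le_add hs ht).trans (by norm_num))
  have hw1 : ∀ k, ∑' i, w k i ≤ 1 := fun k => by
    simp only [w, div_eq_mul_inv, ENNReal.tsum_mul_right, ENNReal.tsum_add]
    exact half ((hb _).trans (pow_le_one' (he.enorm_le_one k) 2))
      ((hcB _).trans (pow_le_one' (hf.enorm_le_one k) 2))
  have hw2 : ∀ i, ∑' k, w k i ≤ 1 := fun i => by
    simp only [w, div_eq_mul_inv, ENNReal.tsum_mul_right, ENNReal.tsum_add, hsymm (b i),
      hsymm (c i)]
    exact half ((he _).trans (pow_le_one' (hb.enorm_le_one i) 2))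
      ((hf _).trans (pow_le_one' (hcB.enorm_le_one i) 2))
  have hle : ∀ k, ‖inner ℂ (f k) (x (e k))‖ₑ ≤ ∑' i, w k i * (μ i : ℝ≥0∞) := fun k => by
    rw [← (hx.hasSum_inner (f k) (e k)).tsum_eq]
    refine enorm_tsum_le_tsum_enorm.trans (ENNReal.tsum_le_tsum fun i => ?_)
    rw [enorm_mul, enorm_mul, hsymm (f k), mul_comm]
    gcongr
    · exact enorm_mul_le_half_add_sq _ _
    · simp [enorm_eq_nnnorm]
  calc _ ≤ ∑' k, ∑' i, w k i * (μ i : ℝ≥0∞) ^ p := by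
        refine ENNReal.tsum_le_tsum fun k => le_trans ?_ (tsum_mul_rpow_le hp (hw1 k) _)
        exact ENNReal.rpow_le_rpow (hle k) (by linarith)
    _ = ∑' i, (∑' k, w k i) * (μ i : ℝ≥0∞) ^ p := by
        rw [ENNReal.tsum_comm]
        simp only [ENNReal.tsum_mul_right]
    _ ≤ _ := ENNReal.tsum_le_tsum fun i => mul_le_of_le_one_left' (hw2 i)

theorem enorm_inner_leftVector_apply (hx : IsDiagonal b μ (CFC.abs x)) (i : ι) :
    ‖inner ℂ (leftVector b μ x i) (x (b i))‖ₑ = μ i := by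
  rw [hx.inner_leftVector_apply]
  simp [enorm_eq_nnnorm]

section Inequalities

variable {κ κ' : Type*} {y : H →L[ℂ] H} {c : HilbertBasis κ ℂ H} {ν : κ → ℝ≥0}
  {d : HilbertBasis κ' ℂ H} {σ : κ' → ℝ≥0}

/-- Each `σ i` is the matrix coefficient of `x + y` at its own singular vectors. Split it, use
convexity of the power, and bound both parts by the variational inequality. -/
theorem tsum_rpow_add_le (hx : IsDiagonal b μ (CFC.abs x)) (hy : IsDiagonal c ν (CFC.abs y))
    (hxy : IsDiagonal d σ (CFC.abs (x + y))) {p : ℝ} (hp : 1 ≤ p) :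
    ∑' i, (σ i : ℝ≥0∞) ^ p ≤
      2 ^ (p - 1) * (∑' i, (μ i : ℝ≥0∞) ^ p + ∑' i, (ν i : ℝ≥0∞) ^ p) := by
  have hd := d.orthonormal.isBessel
  have hl := hxy.isBessel_leftVector
  calc _ ≤ ∑' i, 2 ^ (p - 1) * (‖inner ℂ (leftVector d σ (x + y) i) (x (d i))‖ₑ ^ p +
        ‖inner ℂ (leftVector d σ (x + y) i) (y (d i))‖ₑ ^ p) := by
        refine ENNReal.tsum_le_tsum fun i => ?_
        refine le_trans ?_ (ENNReal.rpow_add_le_mul_rpow_add_rpow _ _ hp)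
        rw [← hxy.enorm_inner_leftVector_apply]
        refine ENNReal.rpow_le_rpow ?_ (by linarith)
        rw [add_apply, inner_add_right]
        exact enorm_add_le _ _
    _ ≤ _ := by
        rw [ENNReal.tsum_mul_left, ENNReal.tsum_add]
        gcongr
        · exact hx.tsum_enorm_inner_rpow_le hd hl hp
        · exact hy.tsum_enorm_inner_rpow_le hd hl hp

theorem tsum_mul_le (hx : IsDiagonal b μ (CFC.abs x)) (hy : IsDiagonal c ν (CFC.abs y))
    (hxy : IsDiagonal d σ (CFC.abs (x * y))) {p q : ℝ} (hpq : p.HolderConjugate q) :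
    ∑' i, (σ i : ℝ≥0∞) ≤
      (∑' i, (μ i : ℝ≥0∞) ^ p) ^ (1 / p) * (∑' i, (ν i : ℝ≥0∞) ^ q) ^ (1 / q) := by
  have hq := hpq.symm.pos
  rw [ENNReal.tsum_eq_iSup_sum]
  refine iSup_le fun s => ?_
  let f := leftVector d σ (x * y)
  -- Collecting `∑ i ∈ s, ⟪f i, x y (d i)⟫` by the `j`-th term of the decomposition of `x` leaves `μ
  -- j * ⟪b j, y (h j)⟫`. Finiteness of `s` makes `h j` a finite sum.
  let h : ι → H := fun j => ∑ i ∈ s, inner ℂ (f i) (leftVector b μ x j) • d i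
  have hh : IsBessel h := hx.isBessel_leftVector.sum_inner_smul d.orthonormal.isBessel
    hxy.isBessel_leftVector s
  have hsum : HasSum (fun j => ((μ j : ℝ) : ℂ) * inner ℂ (b j) (y (h j)))
      (((∑ i ∈ s, (σ i : ℝ) : ℝ)) : ℂ) := by
    rw [Complex.ofReal_sum]
    simp only [← hxy.inner_leftVector_apply]
    convert! hasSum_sum fun i (_ : i ∈ s) =>
      hx.hasSum_inner (leftVector d σ (x * y) i) (y (d i)) using 1
    funext j
    simp only [h, f, map_sum, map_smul, inner_sum, inner_smul_right, Finset.mul_sum]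
    exact Finset.sum_congr rfl fun i _ => by ring
  calc ∑ i ∈ s, (σ i : ℝ≥0∞) = ‖(((∑ i ∈ s, (σ i : ℝ) : ℝ)) : ℂ)‖ₑ := by
        rw [← NNReal.coe_sum]
        simp [enorm_eq_nnnorm, -NNReal.coe_sum]
    _ ≤ ∑' j, (μ j : ℝ≥0∞) * ‖inner ℂ (b j) (y (h j))‖ₑ := by
        rw [← hsum.tsum_eq]
        refine enorm_tsum_le_tsum_enorm.trans (ENNReal.tsum_le_tsum fun j => ?_)
        rw [enorm_mul]
        simp [enorm_eq_nnnorm]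
    _ ≤ _ := (tsum_mul_le_Lp_mul_Lq hpq _ _)
    _ ≤ _ := by
        gcongr
        exact hy.tsum_enorm_inner_rpow_le hh b.orthonormal.isBessel hpq.symm.lt.le

/-- Scaling `y` to a contraction `T` keeps `T (d i)` a Bessel family, so the variational bound for
`x` with exponent one applies. -/
theorem tsum_mul_le_opNorm (hx : IsDiagonal b μ (CFC.abs x))
    (hxy : IsDiagonal d σ (CFC.abs (x * y))) :
    ∑' i, (σ i : ℝ≥0∞) ≤ (∑' i, (μ i : ℝ≥0∞)) * ENNReal.ofReal ‖y‖ := by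
  let T : H →L[ℂ] H := ((‖y‖ : ℂ)⁻¹) • y
  have hT : ‖T‖ ≤ 1 := by
    rw [norm_smul]
    simpa using inv_mul_le_one
  have hyT : ∀ v, y v = (‖y‖ : ℂ) • T v := fun v => by
    rcases eq_or_ne y 0 with h0 | h0
    · simp [h0]
    · have : (‖y‖ : ℂ) ≠ 0 := by exact_mod_cast norm_ne_zero_iff.2 h0
      simp [T, smul_smul, this]
  have key := hx.tsum_enorm_inner_rpow_le (d.orthonormal.isBessel.comp hT)
    hxy.isBessel_leftVector le_rfl
  simp only [ENNReal.rpow_one] at key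
  calc ∑' i, (σ i : ℝ≥0∞)
      = (∑' i, ‖inner ℂ (leftVector d σ (x * y) i) (x (T (d i)))‖ₑ) * ENNReal.ofReal ‖y‖ := by
        rw [← ENNReal.tsum_mul_right]
        refine tsum_congr fun i => ?_
        rw [← hxy.enorm_inner_leftVector_apply, mul_apply_eq_comp, hyT, map_smul,
          inner_smul_right, enorm_mul, mul_comm, ← ofReal_norm (‖y‖ : ℂ), Complex.norm_real, norm_norm]
    _ ≤ _ := by gcongr

end Inequalities

end IsDiagonal


/-! ### Traces, Schatten norms and Luxemburg norms -/

theorem singularValue_abs (x : H →L[ℂ] H) : singularValue (CFC.abs x) = singularValue x := by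
  have h : eigenspaceGE (CFC.abs x) = eigenspaceGE x := by
    funext t
    rw [eigenspaceGE, eigenspaceGE, CFC.abs_of_nonneg _ (CFC.abs_nonneg x)]
  funext n
  rw [singularValue, singularValue, h]

theorem IsDiagonal.tsum_singularValue_rpow {ι : Type*} {b : HilbertBasis ι ℂ H} {μ : ι → ℝ≥0}
    {x : H →L[ℂ] H} (hx : IsDiagonal b μ (CFC.abs x)) {p : ℝ} (hp : 0 < p) :
    ∑' n, (singularValue x n : ℝ≥0∞) ^ p = ∑' i, (μ i : ℝ≥0∞) ^ p := by
  rw [← singularValue_abs]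
  exact hx.tsum_singularValue (g := fun t => (t : ℝ≥0∞) ^ p) (by simp [hp])

theorem posTrace_abs_rpow {x : H →L[ℂ] H} (hx : IsCompactOperator x) {p : ℝ} (hp : 0 < p) :
    posTrace (CFC.abs x ^ p) = ∑' n, (singularValue x n : ℝ≥0∞) ^ p := by
  obtain ⟨ι, b, μ, h⟩ := exists_isDiagonal_abs hx
  rw [h.tsum_singularValue_rpow hp, (h.rpow hp).posTrace_eq]
  exact tsum_congr fun i => (ENNReal.coe_rpow_of_nonneg _ hp.le)

theorem tsum_singularValue_abs_rpow {x : H →L[ℂ] H} (hx : IsCompactOperator x) {p : ℝ}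
    (hp : 0 < p) : ∑' n, (singularValue (CFC.abs x ^ p) n : ℝ≥0∞) =
      ∑' n, (singularValue x n : ℝ≥0∞) ^ p := by
  obtain ⟨ι, b, μ, h⟩ := exists_isDiagonal_abs hx
  rw [h.tsum_singularValue_rpow hp,
    (h.rpow hp).tsum_singularValue (g := fun t => (t : ℝ≥0∞)) (by simp)]
  exact tsum_congr fun i => (ENNReal.coe_rpow_of_nonneg _ hp.le)

theorem schattenNorm_rpow (x : H →L[ℂ] H) {p : ℝ} (hp : 0 < p) :
    schattenNorm p x ^ p = ∑' n, (singularValue x n : ℝ≥0∞) ^ p := by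
  rw [schattenNorm, ← ENNReal.rpow_mul, one_div_mul_cancel hp.ne', ENNReal.rpow_one]

theorem tsum_singularValue_rpow_ne_zero {x : H →L[ℂ] H} (hx : IsCompactOperator x) (h0 : x ≠ 0)
    {p : ℝ} (hp : 0 < p) : ∑' n, (singularValue x n : ℝ≥0∞) ^ p ≠ 0 := by
  obtain ⟨ι, b, μ, h⟩ := exists_isDiagonal_abs hx
  rw [h.tsum_singularValue_rpow hp]
  intro hz
  apply h0
  ext v
  have hb : ∀ i, x (b i) = 0 := fun i => by
    have := ENNReal.tsum_eq_zero.1 hz i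
    rw [ENNReal.rpow_eq_zero_iff_of_pos hp, ENNReal.coe_eq_zero] at this
    rw [← h.smul_leftVector i, this]
    simp
  have := (b.hasSum_repr v).mapL x
  simp only [map_smul, hb, smul_zero] at this
  exact this.unique hasSum_zero

/-- By homogeneity `r` is admissible exactly when `schattenNorm p x ≤ r`. The norm is positive and
finite, so it is itself admissible and the infimum is attained. -/
theorem luxemburgNorm_powFun {x : H →L[ℂ] H} {p : ℝ} (hp : 0 < p)
    (h0 : ∑' n, (singularValue x n : ℝ≥0∞) ^ p ≠ 0)
    (htop : ∑' n, (singularValue x n : ℝ≥0∞) ^ p ≠ ∞) :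
    luxemburgNorm (powFun p) x = schattenNorm p x := by
  have hiff : ∀ r : ℝ≥0, 0 < r →
      (∑' n, powFun p (singularValue x n / r) ≤ 1 ↔ schattenNorm p x ≤ r) := fun r hr => by
    have hr0 : (r : ℝ≥0∞) ≠ 0 := by exact_mod_cast hr.ne'
    have h1 : ∑' n, powFun p (singularValue x n / r) =
        (∑' n, (singularValue x n : ℝ≥0∞) ^ p) / (r : ℝ≥0∞) ^ p := by
      rw [div_eq_mul_inv, ← ENNReal.tsum_mul_right]
      refine tsum_congr fun n => ?_
      rw [powFun, ENNReal.coe_div hr.ne', ENNReal.div_rpow_of_nonneg _ _ hp.le, div_eq_mul_inv]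
    have hrp : (r : ℝ≥0∞) ^ p ≠ 0 := by simp [ENNReal.rpow_eq_zero_iff_of_pos hp, hr.ne']
    have hrt : (r : ℝ≥0∞) ^ p ≠ ∞ := ENNReal.rpow_ne_top_of_nonneg hp.le ENNReal.coe_ne_top
    rw [h1, ENNReal.div_le_iff hrp hrt, one_mul, ← schattenNorm_rpow x hp,
      ENNReal.rpow_le_rpow_iff hp]
  have hS0 : schattenNorm p x ≠ 0 := by
    intro h
    rw [← schattenNorm_rpow x hp, h, ENNReal.zero_rpow_of_pos hp] at h0
    exact h0 rfl
  have hSt : schattenNorm p x ≠ ∞ := by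
    intro h
    rw [← schattenNorm_rpow x hp, h, ENNReal.top_rpow_of_pos hp] at htop
    exact htop rfl
  apply le_antisymm
  · lift schattenNorm p x to ℝ≥0 using hSt with r hr
    have hr0 : 0 < r := pos_iff_ne_zero.2 (by exact_mod_cast hS0)
    exact iInf_le_of_le (⟨r, hr0, (hiff r hr0).2 le_rfl⟩ :
      {r : ℝ≥0 // 0 < r ∧ ∑' n, powFun p (singularValue x n / r) ≤ 1}) le_rfl
  · exact le_iInf fun r => (hiff r r.2.1).1 r.2.2

theorem posTrace_smul {c : ℝ} (hc : 0 ≤ c) (A : H →L[ℂ] H) :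
    posTrace (c • A) = ENNReal.ofReal c * posTrace A := by
  rw [posTrace, posTrace, ← ENNReal.tsum_mul_left]
  refine tsum_congr fun i => ?_
  rw [← ENNReal.ofReal_mul hc, smul_apply, RCLike.real_smul_eq_coe_smul (K := ℂ),
    inner_smul_right, RCLike.re_ofReal_mul]

theorem isDiagonal_rankOne {ι : Type*} [DecidableEq ι] (e : HilbertBasis ι ℂ H) (n : ι) :
    IsDiagonal e (fun i => if i = n then 1 else 0) (InnerProductSpace.rankOne ℂ (e n) (e n)) where
  nonneg := by
    rw [ContinuousLinearMap.nonneg_iff_isPositive]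
    exact InnerProductSpace.isPositive_rankOne_self (e n)
  apply_basis i := by
    rw [InnerProductSpace.rankOne_apply, orthonormal_iff_ite.1 e.orthonormal n i]
    split_ifs with h1 h2 h2
    · simp [h1]
    · exact absurd h1.symm h2
    · exact absurd h2.symm h1
    · simp
  finite t ht := by
    refine (Set.finite_singleton n).subset fun i (hi : t ≤ _) => ?_
    by_contra hin
    rw [if_neg (show i ≠ n from hin)] at hi
    exact absurd hi (not_le.2 ht)

/-- The only nonzero eigenvalue is a simple `1`, so admissibility of `r` reads `φ (1 / r) ≤ 1`;
strict monotonicity of `ψ` turns this into `1 / ψ.symm 1 ≤ r`. -/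
theorem luxemburgNorm_rankOne {φ : ℝ≥0 → ℝ≥0∞} (hφ : IsOrlicz φ) (ψ : ℝ≥0 ≃ ℝ≥0)
    (hψ : ∀ t, φ t = (ψ t : ℝ≥0∞)) {ι : Type*} (e : HilbertBasis ι ℂ H) (n : ι) :
    luxemburgNorm φ (InnerProductSpace.rankOne ℂ (e n) (e n)) =
      ((1 / ψ.symm 1 : ℝ≥0) : ℝ≥0∞) := by
  classical
  have hmono : StrictMono ψ := by
    refine Monotone.strictMono_of_injective (fun s t hst => ?_) ψ.injective
    have := hφ.mono hst
    rw [hψ, hψ] at this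
    exact_mod_cast this
  have hψ0 : ψ 0 = 0 := by
    have := hφ.map_zero
    rw [hψ] at this
    exact_mod_cast this
  have hs : 0 < ψ.symm 1 := by
    rw [← hmono.lt_iff_lt, ψ.apply_symm_apply, hψ0]
    exact one_pos
  have hsum : ∀ r : ℝ≥0, ∑' k,
      φ (singularValue (InnerProductSpace.rankOne ℂ (e n) (e n)) k / r) = φ (1 / r) := fun r => by
    rw [(isDiagonal_rankOne e n).tsum_singularValue (g := fun t => φ (t / r))
      (by simp [hφ.map_zero]), tsum_eq_single n]
    · simp
    · intro i hi
      simp [hi, hφ.map_zero]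
  have hiff : ∀ r : ℝ≥0, 0 < r → (∑' k,
      φ (singularValue (InnerProductSpace.rankOne ℂ (e n) (e n)) k / r) ≤ 1 ↔
        1 / ψ.symm 1 ≤ r) := fun r hr => by
    rw [hsum, hψ, ← ENNReal.coe_one, ENNReal.coe_le_coe, ← ψ.apply_symm_apply 1,
      hmono.le_iff_le, ψ.apply_symm_apply, div_le_iff₀ hr, div_le_iff₀ hs, mul_comm]
  apply le_antisymm
  · have h1 : 0 < 1 / ψ.symm 1 := by positivity
    exact iInf_le_of_le ⟨1 / ψ.symm 1, h1, (hiff _ h1).2 le_rfl⟩ le_rfl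
  · exact le_iInf fun r => ENNReal.coe_le_coe.2 ((hiff r r.2.1).1 r.2.2)

theorem posTrace_inv_smul_abs_rpow {x : H →L[ℂ] H} {p : ℝ} (hp : 0 < p)
    (hx : x ∈ schattenClass H p) (h0 : x ≠ 0) :
    posTrace ((((schattenNorm p x).toReal ^ p)⁻¹ : ℝ) • CFC.abs x ^ p) = 1 := by
  have hne := tsum_singularValue_rpow_ne_zero hx.1 h0 hp
  rw [posTrace_smul (by positivity), posTrace_abs_rpow hx.1 hp, ENNReal.toReal_rpow,
    schattenNorm_rpow x hp, ENNReal.ofReal_inv_of_pos (ENNReal.toReal_pos hne hx.2.ne),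
    ENNReal.ofReal_toReal hx.2.ne, ENNReal.inv_mul_cancel hne hx.2.ne]

theorem tsum_singularValue_add_rpow_le {x y : H →L[ℂ] H} (hx : IsCompactOperator x)
    (hy : IsCompactOperator y) {p : ℝ} (hp : 1 ≤ p) :
    ∑' n, (singularValue (x + y) n : ℝ≥0∞) ^ p ≤ 2 ^ (p - 1) *
      (∑' n, (singularValue x n : ℝ≥0∞) ^ p + ∑' n, (singularValue y n : ℝ≥0∞) ^ p) := by
  have hp0 : 0 < p := by linarith
  obtain ⟨ι, b, μ, h⟩ := exists_isDiagonal_abs hx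
  obtain ⟨κ, c, ν, h'⟩ := exists_isDiagonal_abs hy
  obtain ⟨κ', d, σ, h''⟩ := exists_isDiagonal_abs (x := x + y) (hx.add hy)
  rw [h.tsum_singularValue_rpow hp0, h'.tsum_singularValue_rpow hp0,
    h''.tsum_singularValue_rpow hp0]
  exact h.tsum_rpow_add_le h' h'' hp

theorem tsum_singularValue_mul_le {x y : H →L[ℂ] H} (hx : IsCompactOperator x)
    (hy : IsCompactOperator y) {p q : ℝ} (hpq : p.HolderConjugate q) :
    ∑' n, (singularValue (x * y) n : ℝ≥0∞) ≤ schattenNorm p x * schattenNorm q y := by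
  obtain ⟨ι, b, μ, h⟩ := exists_isDiagonal_abs hx
  obtain ⟨κ, c, ν, h'⟩ := exists_isDiagonal_abs hy
  obtain ⟨κ', d, σ, h''⟩ := exists_isDiagonal_abs (x := x * y) (hx.comp_clm y)
  have h1 := h''.tsum_singularValue_rpow one_pos
  simp only [ENNReal.rpow_one] at h1
  rw [schattenNorm, schattenNorm, h.tsum_singularValue_rpow hpq.pos,
    h'.tsum_singularValue_rpow hpq.symm.pos, h1]
  exact h.tsum_mul_le h' h'' hpq

theorem tsum_singularValue_mul_le_opNorm {x : H →L[ℂ] H} (hx : IsCompactOperator x)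
    (y : H →L[ℂ] H) : ∑' n, (singularValue (x * y) n : ℝ≥0∞) ≤
      (∑' n, (singularValue x n : ℝ≥0∞)) * ENNReal.ofReal ‖y‖ := by
  obtain ⟨ι, b, μ, h⟩ := exists_isDiagonal_abs hx
  obtain ⟨κ', d, σ, h''⟩ := exists_isDiagonal_abs (x := x * y) (hx.comp_clm y)
  have h1 := h''.tsum_singularValue_rpow one_pos
  have h2 := h.tsum_singularValue_rpow one_pos
  simp only [ENNReal.rpow_one] at h1 h2
  rw [h1, h2]
  exact h.tsum_mul_le_opNorm h''

theorem posTrace_abs {x : H →L[ℂ] H} (hx : IsCompactOperator x) :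
    posTrace (CFC.abs x) = ∑' n, (singularValue x n : ℝ≥0∞) := by
  have := posTrace_abs_rpow hx one_pos
  simpa only [CFC.rpow_one _ (CFC.abs_nonneg x), ENNReal.rpow_one] using this

end SchattenOrlicz

end

theorem corollary3p1 {H : Type*} [NormedAddCommGroup H] [InnerProductSpace ℂ H] [CompleteSpace H]
    [TopologicalSpace.SeparableSpace H] :
    -- (1) normalisation of the trace, for the Luxemburg norm of `t ↦ t ^ p` and the Schatten norm
    (∀ p : ℝ, 1 ≤ p → ∀ x ∈ schattenClass H p, x ≠ 0 →
      posTrace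
        ((((luxemburgNorm (powFun p) x).toReal ^ p)⁻¹ : ℝ) •
          CFC.abs x ^ p) = 1 ∧
      posTrace
        ((((schattenNorm p x).toReal ^ p)⁻¹ : ℝ) • CFC.abs x ^ p) = 1 ∧
      posTrace (CFC.abs x ^ p) / schattenNorm p x ^ p = 1) ∧
    -- (2) the quasi-triangle inequality, for traces and for singular values
    (∀ p : ℝ, 1 ≤ p →
      ∀ x ∈ schattenClass H p, ∀ y ∈ schattenClass H p,
      posTrace (CFC.abs (x + y) ^ p) ≤
        2 ^ (p - 1) *
          (posTrace (CFC.abs x ^ p) + posTrace (CFC.abs y ^ p)) ∧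
      posTrace (CFC.abs (x + y) ^ p) < ∞ ∧
      ∑' n, (singularValue (CFC.abs (x + y) ^ p) n : ℝ≥0∞) ≤
        2 ^ (p - 1) *
          (∑' n, (singularValue (CFC.abs x ^ p) n : ℝ≥0∞) +
            ∑' n, (singularValue (CFC.abs y ^ p) n : ℝ≥0∞))) ∧
    -- (3) the Hölder inequality, first for `1 < p, q < ∞`, then for `p = 1`, `q = ∞`
    (∀ p q : ℝ, 1 < p → 1 / p + 1 / q = 1 →
      ∀ x ∈ schattenClass H p, ∀ y ∈ schattenClass H q,
      posTrace (CFC.abs (x * y)) ≤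
        schattenNorm p x * schattenNorm q y ∧
      posTrace (CFC.abs (x * y)) < ∞ ∧
      ∑' n, (singularValue (CFC.abs (x * y)) n : ℝ≥0∞) ≤
        (∑' n, (singularValue (CFC.abs x) n : ℝ≥0∞) ^ p) ^ (1 / p) *
          (∑' n, (singularValue (CFC.abs y) n : ℝ≥0∞) ^ q) ^ (1 / q) ∧
      (∑' n, (singularValue (CFC.abs x) n : ℝ≥0∞) ^ p) ^ (1 / p) *
          (∑' n, (singularValue (CFC.abs y) n : ℝ≥0∞) ^ q) ^ (1 / q) =
        posTrace (CFC.abs x ^ p) ^ (1 / p) *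
          posTrace (CFC.abs y ^ q) ^ (1 / q)) ∧
    (∀ x ∈ schattenClass H 1, ∀ y : H →L[ℂ] H,
      posTrace (CFC.abs (x * y)) ≤
        schattenNorm 1 x * ENNReal.ofReal ‖y‖ ∧
      posTrace (CFC.abs (x * y)) < ∞ ∧
      ∑' n, (singularValue (CFC.abs (x * y)) n : ℝ≥0∞) ≤
        (∑' n, (singularValue (CFC.abs x) n : ℝ≥0∞)) * ENNReal.ofReal ‖y‖ ∧
      schattenNorm 1 x = posTrace (CFC.abs x)) ∧
    -- (4) the Luxemburg norm of `eₙ ⊗ eₙ`; `φ` is invertible with inverse `ψ.symm` on `[0,∞)`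
    (∀ φ : ℝ≥0 → ℝ≥0∞, IsOrlicz φ → DeltaTwoZero φ →
      ∀ ψ : ℝ≥0 ≃ ℝ≥0, (∀ t, φ t = (ψ t : ℝ≥0∞)) →
      ∀ {ι : Type*} (e : HilbertBasis ι ℂ H) (n : ι),
      luxemburgNorm φ (InnerProductSpace.rankOne ℂ (e n) (e n)) =
        ((1 / ψ.symm 1 : ℝ≥0) : ℝ≥0∞)) := by
  refine ⟨fun p hp x hx h0 => ?_, fun p hp x hx y hy => ?_, fun p q hp hpq x hx y hy => ?_,
    fun x hx y => ?_, fun φ hφ _ ψ hψ ι e n => luxemburgNorm_rankOne hφ ψ hψ e n⟩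
  · have hp0 : 0 < p := by linarith
    have hne := tsum_singularValue_rpow_ne_zero hx.1 h0 hp0
    refine ⟨?_, posTrace_inv_smul_abs_rpow hp0 hx h0, ?_⟩
    · rw [luxemburgNorm_powFun hp0 hne hx.2.ne]
      exact posTrace_inv_smul_abs_rpow hp0 hx h0
    · rw [schattenNorm_rpow x hp0, posTrace_abs_rpow hx.1 hp0, ENNReal.div_self hne hx.2.ne]
  · have hp0 : 0 < p := by linarith
    have hxy : IsCompactOperator (x + y : H →L[ℂ] H) := hx.1.add hy.1
    have key := tsum_singularValue_add_rpow_le hx.1 hy.1 hp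
    rw [posTrace_abs_rpow hxy hp0, posTrace_abs_rpow hx.1 hp0, posTrace_abs_rpow hy.1 hp0,
      tsum_singularValue_abs_rpow hxy hp0, tsum_singularValue_abs_rpow hx.1 hp0,
      tsum_singularValue_abs_rpow hy.1 hp0]
    refine ⟨key, key.trans_lt ?_, key⟩
    exact ENNReal.mul_lt_top
      (ENNReal.rpow_lt_top_of_nonneg (sub_nonneg.2 hp) ENNReal.ofNat_ne_top)
      (ENNReal.add_lt_top.2 ⟨hx.2, hy.2⟩)
  · have hc : p.HolderConjugate q :=
      Real.holderConjugate_iff.2 ⟨hp, by simpa only [one_div] using hpq⟩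
    have hxy : IsCompactOperator (x * y : H →L[ℂ] H) := hx.1.comp_clm y
    have key := tsum_singularValue_mul_le hx.1 hy.1 hc
    simp only [singularValue_abs]
    rw [posTrace_abs hxy, posTrace_abs_rpow hx.1 hc.pos, posTrace_abs_rpow hy.1 hc.symm.pos]
    refine ⟨key, key.trans_lt (ENNReal.mul_lt_top ?_ ?_), key, rfl⟩
    · exact ENNReal.rpow_lt_top_of_nonneg (one_div_nonneg.2 hc.nonneg) hx.2.ne
    · exact ENNReal.rpow_lt_top_of_nonneg (one_div_nonneg.2 hc.symm.nonneg) hy.2.ne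
  · have hxy : IsCompactOperator (x * y : H →L[ℂ] H) := hx.1.comp_clm y
    have key := tsum_singularValue_mul_le_opNorm hx.1 y
    have hnorm : schattenNorm 1 x = ∑' n, (singularValue x n : ℝ≥0∞) := by
      simp [schattenNorm]
    have hfin : ∑' n, (singularValue x n : ℝ≥0∞) < ∞ := by simpa using hx.2
    simp only [singularValue_abs]
    rw [posTrace_abs hxy, posTrace_abs hx.1, hnorm]
    exact ⟨key, key.trans_lt (ENNReal.mul_lt_top hfin ENNReal.ofReal_lt_top), key, rfl⟩
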